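/- A pseudocomplemented distributive lattice is an algebra $(L,\vee,\wedge,0,1,{}^*)$ such that $(L,\vee,\wedge,0,1)$ is a bounded distributive lattice and, for all $x,y\in L$, $x\le y^*$ if and only if $x\wedge y=0$. Homomorphisms of these algebras (maps preserving $\vee,\wedge,0,1$ and ${}^*$) are called $*$-homomorphisms. For $n\ge 0$ let $B_n^+=\mathbf 2^n\oplus\mathbf 1$ be the Boolean lattice $\mathbf 2^n$ with a new top element adjoined, regarded as a pseudocomplemented distributive lattice, and let $\mathcal B_n$ be the variety generated by $B_n^+$. An algebra $A$ in $\mathcal B_n$ is an amalgamation base of $\mathcal B_n$ if for all $B_0,B_1$ in $\mathcal B_n$ and all one-to-one $*$-homomorphisms $\alpha_0:A\to B_0$ and $\alpha_1:A\to B_1$ there exist $C$ in $\mathcal B_n$ and one-to-one $*$-homomorphisms $\beta_0:B_0\to C$ and $\beta_1:B_1\to C$ such that $\beta_0\circ\alpha_0=\beta_1\circ\alpha_1$. **Proposition.** Let $n\ge 2$ and let $A$ be in $\mathcal B_n$. Assume that, for every $B$ in $\mathcal B_n$ containing $A$ as a subalgebra, every $*$-homomorphism from $A$ to $B_n^+$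 can be extended to a $*$-homomorphism from $B$ to $B_n^+$. Then $A$ is an amalgamation base of $\mathcal B_n$. -/

import Mathlib

universe u v

/-- A pseudocomplemented distributive lattice `(L, ⊔, ⊓, ⊥, ⊤, ᶜ)`: a bounded distributive lattice
with a unary operation `ᶜ` (written `*` in the literature) such that `x ≤ yᶜ ↔ x ⊓ y = ⊥`.
The one-element algebra is allowed. -/
class PseudocomplDistribLattice (L : Type u) extends DistribLattice L, BoundedOrder L, Compl L where
  /-- `yᶜ` is the pseudocomplement of `y`. -/
  le_compl_iff_inf_eq_bot : ∀ x y : L, x ≤ yᶜ ↔ x ⊓ y = ⊥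

/-- A `*`-homomorphism: a map preserving `⊔`, `⊓`, `⊥`, `⊤` and the pseudocomplementation. -/
structure PseudocomplHom (L : Type u) (M : Type v) [PseudocomplDistribLattice L]
    [PseudocomplDistribLattice M] extends BoundedLatticeHom L M where
  /-- The map preserves pseudocomplements. -/
  map_compl' : ∀ x : L, toFun xᶜ = (toFun x)ᶜ

instance PseudocomplHom.instFunLike (L : Type u) (M : Type v) [PseudocomplDistribLattice L]
    [PseudocomplDistribLattice M] : FunLike (PseudocomplHom L M) L M where
  coe f := f.toFun
  coe_injective f g h := by
    obtain ⟨f, _⟩ := f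
    obtain ⟨g, _⟩ := g
    congr 1
    exact DFunLike.coe_injective h

/-- Terms in the language of pseudocomplemented distributive lattices, in countably many
variables. -/
inductive PseudocomplTerm : Type
  | var : ℕ → PseudocomplTerm
  | bot : PseudocomplTerm
  | top : PseudocomplTerm
  | sup : PseudocomplTerm → PseudocomplTerm → PseudocomplTerm
  | inf : PseudocomplTerm → PseudocomplTerm → PseudocomplTerm
  | compl : PseudocomplTerm → PseudocomplTerm

/-- The value of a term in an algebra under an assignment of its variables. -/
def PseudocomplTerm.eval {L : Type u} [PseudocomplDistribLattice L] (a : ℕ → L) :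
    PseudocomplTerm → L
  | .var i => a i
  | .bot => ⊥
  | .top => ⊤
  | .sup s t => s.eval a ⊔ t.eval a
  | .inf s t => s.eval a ⊓ t.eval a
  | .compl s => (s.eval a)ᶜ

/-- The algebra `L` satisfies the identity `s ≈ t`. -/
def SatisfiesIdentity (L : Type u) [PseudocomplDistribLattice L] (s t : PseudocomplTerm) : Prop :=
  ∀ a : ℕ → L, s.eval a = t.eval a

/-- `L` belongs to the variety (that is, equational class) generated by the algebra `G`, the
smallest variety containing `G`: every identity true in `G` is true in `L`. -/
def MemVarietyGeneratedBy (G : Type v) [PseudocomplDistribLattice G]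
    (L : Type u) [PseudocomplDistribLattice L] : Prop :=
  ∀ s t : PseudocomplTerm, SatisfiesIdentity G s t → SatisfiesIdentity L s t

/-- The underlying set of `B_n^+ = 2^n ⊕ 1`, the Boolean lattice `2^n` with a new top element. -/
def BPlus (n : ℕ) : Type := WithTop (Fin n → Bool)

noncomputable instance BPlus.instDistribLattice (n : ℕ) : DistribLattice (BPlus n) :=
  inferInstanceAs (DistribLattice (WithTop (Fin n → Bool)))

noncomputable instance BPlus.instBoundedOrder (n : ℕ) : BoundedOrder (BPlus n) :=
  inferInstanceAs (BoundedOrder (WithTop (Fin n → Bool)))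

/-- The pseudocomplement in `2^n ⊕ 1`: `⊤* = ⊥`, `⊥* = ⊤`, and `b*` is the Boolean complement of `b`
for every other `b` in `2^n`. -/
noncomputable def BPlus.pcompl (n : ℕ) : WithTop (Fin n → Bool) → WithTop (Fin n → Bool)
  | none => ⊥
  | some b => if b = ⊥ then ⊤ else ((bᶜ : Fin n → Bool) : WithTop (Fin n → Bool))

theorem BPlus.le_pcompl_iff (n : ℕ) (x y : WithTop (Fin n → Bool)) :
    x ≤ BPlus.pcompl n y ↔ x ⊓ y = ⊥ := by
  cases y with
  | top =>
    change x ≤ ⊥ ↔ x ⊓ ⊤ = ⊥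
    simp
  | coe b =>
    change x ≤ (if b = ⊥ then ⊤ else ((bᶜ : Fin n → Bool) : WithTop (Fin n → Bool))) ↔ _
    by_cases hb : b = ⊥
    · subst hb
      simp
    · rw [if_neg hb]
      cases x with
      | top =>
        simp [hb]
      | coe c =>
        rw [WithTop.coe_le_coe, ← WithTop.coe_inf, ← WithTop.coe_bot, WithTop.coe_inj,
          le_compl_iff_disjoint_right, disjoint_iff]

noncomputable instance BPlus.instPseudocomplDistribLattice (n : ℕ) : PseudocomplDistribLattice (BPlus n) where
  compl := BPlus.pcompl n
  le_compl_iff_inf_eq_bot := BPlus.le_pcompl_iff n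

/-- `L` is in the variety `𝓑_n` generated by `B_n^+ = 2^n ⊕ 1`. -/
def MemB (n : ℕ) (L : Type u) [PseudocomplDistribLattice L] : Prop :=
  MemVarietyGeneratedBy (BPlus n) L

/-- `A` is an amalgamation base of the class `V` of pseudocomplemented distributive lattices,
that is, `A` is in `Amal(V)`. -/
def IsAmalgamationBase (V : ∀ (L : Type u) [PseudocomplDistribLattice L], Prop)
    (A : Type u) [PseudocomplDistribLattice A] : Prop :=
  V A ∧
  ∀ (B₀ B₁ : Type u) [PseudocomplDistribLattice B₀] [PseudocomplDistribLattice B₁],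
    V B₀ → V B₁ →
    ∀ (α₀ : PseudocomplHom A B₀) (α₁ : PseudocomplHom A B₁),
      Function.Injective α₀ → Function.Injective α₁ →
      ∃ (C : Type u) (_ : PseudocomplDistribLattice C), V C ∧
        ∃ (β₀ : PseudocomplHom B₀ C) (β₁ : PseudocomplHom B₁ C),
          Function.Injective β₀ ∧ Function.Injective β₁ ∧
          ∀ a : A, β₀ (α₀ a) = β₁ (α₁ a)

/-!
Two facts carry the proof.

*Homomorphisms into `2^n ⊕ 1` separate the points of every `L` in `𝓑_n`* (`exists_hom_ne`).
Given `x ≰ y`, choose a prime ideal `I` with `y ∈ I` and `x ∉ I`, and let `J` range over the minimal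
prime ideals below `I` (dually, the maximal filters containing the prime filter `L \ I`). There is
at least one of them, and there are at most `n`: from `n + 1` distinct ones one obtains pairwise
disjoint elements `c₀, …, cₙ` with `cᵢ ∉ Jᵢ`, whereas `2^n ⊕ 1`, hence `L`, satisfies the identity
`c₀ᶜ ⊔ ⋯ ⊔ cₙᶜ = ⊤` for the terms `cᵢ = aᵢ ⊓ ⨅ j < i, aⱼᶜ`. Enumerating them as `J₁, …, Jₙ`,
possibly with repetitions, the map that sends the elements outside `I` to the new top, and `a ∈ I`
to `{i | a ∉ Jᵢ}`, is a `*`-homomorphism which separates `x` from `y`.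

*Amalgamation.* Let `C` be the power of `2^n ⊕ 1` indexed by the pairs of homomorphisms
`g₀ : B₀ → 2^n ⊕ 1`, `g₁ : B₁ → 2^n ⊕ 1` that agree on `A`, and let `βᵢ` evaluate `gᵢ`. The square
commutes by construction. By the extension hypothesis every `g₀` occurs in such a pair, and so
does every `g₁`; since these separate points, `β₀` and `β₁` are injective.
-/

/-! ### Pseudocomplements and homomorphisms -/

section Basic

variable {L : Type u} [PseudocomplDistribLattice L]

theorem pcompl_inf_self (a : L) : aᶜ ⊓ a = ⊥ :=
  (PseudocomplDistribLattice.le_compl_iff_inf_eq_bot _ _).1 le_rfl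

theorem inf_pcompl_self (a : L) : a ⊓ aᶜ = ⊥ := by
  rw [inf_comm, pcompl_inf_self]

theorem pcompl_bot : (⊥ : L)ᶜ = ⊤ :=
  top_le_iff.1 ((PseudocomplDistribLattice.le_compl_iff_inf_eq_bot _ _).2 (by simp))

theorem pcompl_le_pcompl {a b : L} (h : a ≤ b) : bᶜ ≤ aᶜ :=
  (PseudocomplDistribLattice.le_compl_iff_inf_eq_bot _ _).2
    (le_bot_iff.1 ((inf_le_inf_left _ h).trans (pcompl_inf_self b).le))

variable {M : Type v} [PseudocomplDistribLattice M]

theorem PseudocomplHom.map_sup (f : PseudocomplHom L M) (a b : L) : f (a ⊔ b) = f a ⊔ f b :=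
  f.map_sup' a b

theorem PseudocomplHom.map_inf (f : PseudocomplHom L M) (a b : L) : f (a ⊓ b) = f a ⊓ f b :=
  f.map_inf' a b

theorem PseudocomplHom.map_top (f : PseudocomplHom L M) : f ⊤ = ⊤ :=
  f.map_top'

theorem PseudocomplHom.map_bot (f : PseudocomplHom L M) : f ⊥ = ⊥ :=
  f.map_bot'

theorem PseudocomplHom.map_compl (f : PseudocomplHom L M) (a : L) : f aᶜ = (f a)ᶜ :=
  f.map_compl' a

/-- The composition of two `*`-homomorphisms. -/
def PseudocomplHom.comp {N : Type*} [PseudocomplDistribLattice N] (g : PseudocomplHom M N)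
    (f : PseudocomplHom L M) : PseudocomplHom L N where
  toFun a := g (f a)
  map_sup' a b := by rw [f.map_sup, g.map_sup]
  map_inf' a b := by rw [f.map_inf, g.map_inf]
  map_top' := by rw [f.map_top, g.map_top]
  map_bot' := by rw [f.map_bot, g.map_bot]
  map_compl' a := by
    rw [f.map_compl, g.map_compl]

end Basic

/-! ### Powers -/

section Power

variable {S : Type u} {G : Type v} [PseudocomplDistribLattice G]

instance Pi.instPseudocomplDistribLattice : PseudocomplDistribLattice (S → G) where
  compl x s := (x s)ᶜ
  le_compl_iff_inf_eq_bot x y := by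
    simp only [Pi.le_def, funext_iff]
    exact forall_congr' fun s => PseudocomplDistribLattice.le_compl_iff_inf_eq_bot (x s) (y s)

theorem PseudocomplTerm.eval_pi (a : ℕ → S → G) (t : PseudocomplTerm) (s : S) :
    t.eval a s = t.eval fun i => a i s := by
  induction t with
  | var i => rfl
  | bot => rfl
  | top => rfl
  | sup t₁ t₂ h₁ h₂ => exact congrArg₂ (· ⊔ ·) h₁ h₂
  | inf t₁ t₂ h₁ h₂ => exact congrArg₂ (· ⊓ ·) h₁ h₂
  | compl t h => exact congrArg (·ᶜ) h

theorem memVarietyGeneratedBy_pi : MemVarietyGeneratedBy G (S → G) := fun s t hst a =>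
  funext fun i => by rw [PseudocomplTerm.eval_pi, PseudocomplTerm.eval_pi, hst]

/-- The `*`-homomorphism into a power given by a family of `*`-homomorphisms. -/
def PseudocomplHom.pi {L : Type*} [PseudocomplDistribLattice L] (f : S → PseudocomplHom L G) :
    PseudocomplHom L (S → G) where
  toFun a s := f s a
  map_sup' a b := funext fun s => (f s).map_sup a b
  map_inf' a b := funext fun s => (f s).map_inf a b
  map_top' := funext fun s => (f s).map_top
  map_bot' := funext fun s => (f s).map_bot
  map_compl' a := funext fun s => (f s).map_compl a

end Power

/-! ### An identity bounding the number of disjoint elements -/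

section Identity

variable {L : Type u} [PseudocomplDistribLattice L]

/-- The term `⨅ j < i, xⱼᶜ`. -/
def PseudocomplTerm.infCompl : ℕ → PseudocomplTerm
  | 0 => .top
  | i + 1 => .inf (infCompl i) (.compl (.var i))

/-- The term `xᵢ ⊓ ⨅ j < i, xⱼᶜ`; for different `i` these terms are disjoint. -/
def PseudocomplTerm.disjointed (i : ℕ) : PseudocomplTerm :=
  .inf (.var i) (infCompl i)

/-- The term `⨆ i < m, cᵢᶜ`, where `cᵢ` is the term `disjointed i`. -/
def PseudocomplTerm.supComplDisjointed : ℕ → PseudocomplTerm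
  | 0 => .bot
  | m + 1 => .sup (supComplDisjointed m) (.compl (disjointed m))

open PseudocomplTerm

theorem infCompl_eval_le (a : ℕ → L) {i j : ℕ} (h : j < i) : (infCompl i).eval a ≤ (a j)ᶜ := by
  induction i with
  | zero => omega
  | succ i ih =>
    rcases Nat.lt_succ_iff_lt_or_eq.1 h with h | rfl
    · exact inf_le_left.trans (ih h)
    · exact inf_le_right

theorem disjointed_eval_inf_eq_bot (a : ℕ → L) {i j : ℕ} (h : i ≠ j) :
    (disjointed i).eval a ⊓ (disjointed j).eval a = ⊥ := by
  wlog hij : j < i generalizing i j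
  · rw [inf_comm]
    exact this h.symm (by omega)
  · refine le_bot_iff.1 ((inf_le_inf (inf_le_right.trans (infCompl_eval_le a hij))
      (inf_le_left : _ ≤ a j)).trans (pcompl_inf_self _).le)

theorem pcompl_le_supComplDisjointed_eval (a : ℕ → L) {i m : ℕ} (h : i < m) :
    ((disjointed i).eval a)ᶜ ≤ (supComplDisjointed m).eval a := by
  induction m with
  | zero => omega
  | succ m ih =>
    rcases Nat.lt_succ_iff_lt_or_eq.1 h with h | rfl
    · exact (ih h).trans le_sup_left
    · exact le_sup_right

/-- Pairwise disjoint nonzero elements of `2^n ⊕ 1` number at most `n`, provided `1 ≤ n`; for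
`n = 0` the top element alone is a counterexample. -/
theorem BPlus.exists_eq_bot_of_disjoint {n : ℕ} (hn : 1 ≤ n) (c : Fin (n + 1) → BPlus n)
    (hc : ∀ i j, i ≠ j → c i ⊓ c j = ⊥) : ∃ i, c i = ⊥ := by
  by_contra! hne
  have key : ∀ i, ∃ b : Fin n → Bool, c i = (show BPlus n from (b : WithTop (Fin n → Bool))) := by
    intro i
    cases hci : (show WithTop (Fin n → Bool) from c i) with
    | coe b => exact ⟨b, hci⟩
    | top =>
      have : Nontrivial (Fin (n + 1)) := Fin.nontrivial_iff_two_le.2 (by omega)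
      obtain ⟨j, hj⟩ := exists_ne i
      have h := hc i j hj.symm
      have hi : c i = ⊤ := hci
      rw [hi, top_inf_eq] at h
      exact absurd h (hne j)
  choose b hb using key
  have hb0 : ∀ i, ∃ k, b i k = true := by
    intro i
    by_contra! h
    refine hne i ((hb i).trans ?_)
    have : b i = ⊥ := funext fun k => by simpa using h k
    rw [this]
    rfl
  choose k hk using hb0
  obtain ⟨i, j, hij, hkk⟩ := Fintype.exists_ne_map_eq_of_card_lt k (by simp)
  have h := hc i j hij
  rw [hb i, hb j] at h
  have h' : b i ⊓ b j = ⊥ := WithTop.coe_injective h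
  have h'' := congrFun h' (k i)
  rw [Pi.inf_apply, hk i, hkk, hk j] at h''
  exact Bool.noConfusion h''

theorem BPlus.satisfies_supComplDisjointed {n : ℕ} (hn : 1 ≤ n) :
    SatisfiesIdentity (BPlus n) (supComplDisjointed (n + 1)) .top := by
  intro a
  obtain ⟨i, hi⟩ := BPlus.exists_eq_bot_of_disjoint hn
    (fun i : Fin (n + 1) => (disjointed i).eval a)
    fun i j hij => disjointed_eval_inf_eq_bot a (Fin.val_ne_of_ne hij)
  have h := pcompl_le_supComplDisjointed_eval a i.2
  rw [hi, pcompl_bot] at h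
  exact top_le_iff.1 h

end Identity

/-! ### Minimal prime ideals -/

section MinimalPrimes

open Order PseudocomplTerm

variable {L : Type u} [PseudocomplDistribLattice L]

/-- The minimal prime ideals contained in `I`. In a pseudocomplemented distributive lattice, a prime
ideal is minimal exactly when it never contains both an element and its pseudocomplement. -/
def minimalPrimesBelow (I : Ideal L) : Set (Ideal L) :=
  {J | J.IsPrime ∧ J ≤ I ∧ ∀ a ∈ J, aᶜ ∉ J}

theorem Order.Ideal.IsPrime.pcompl_mem {J : Ideal L} (hJ : J.IsPrime) {a : L} (ha : a ∉ J) :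
    aᶜ ∈ J :=
  (hJ.mem_or_mem (by rw [inf_pcompl_self]; exact J.bot_mem)).resolve_left ha

/-- Distinct minimal prime ideals are incomparable. -/
theorem exists_mem_notMem_of_ne {I J K : Ideal L} (hJ : J ∈ minimalPrimesBelow I)
    (hK : K ∈ minimalPrimesBelow I) (h : J ≠ K) : ∃ b ∈ K, b ∉ J := by
  by_contra! hKJ
  refine h (le_antisymm (fun b hb => ?_) hKJ)
  by_contra hbK
  exact hJ.2.2 b hb (hKJ _ (hK.1.pcompl_mem hbK))

/-- If `aᶜ` lies in the prime ideal `I`, then some minimal prime ideal below `I` omits `a`. -/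
theorem exists_minimalPrimesBelow_notMem {I : Ideal L} (hI : I.IsPrime) {a : L} (ha : aᶜ ∈ I) :
    ∃ J ∈ minimalPrimesBelow I, a ∉ J := by
  -- The filter generated by `a`, the complement of `I`, and the dense elements.
  let s : Set L := {z | ∃ p, p ∉ I ∧ zᶜ ⊓ (p ⊓ a) = ⊥}
  have hs : IsPFilter s := by
    refine IsPFilter.of_def ?_ ?_ ?_
    · exact ⟨⊤, ⊤, hI.top_notMem,
        le_bot_iff.1 ((inf_le_inf_left _ inf_le_left).trans (pcompl_inf_self ⊤).le)⟩
    · rintro z ⟨p, hp, hz⟩ w ⟨q, hq, hw⟩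
      refine ⟨z ⊓ w, ⟨p ⊓ q, fun h => (hI.mem_or_mem h).elim hp hq, ?_⟩, inf_le_left, inf_le_right⟩
      have h1 : (z ⊓ w)ᶜ ⊓ z ≤ wᶜ :=
        (PseudocomplDistribLattice.le_compl_iff_inf_eq_bot _ _).2
          (by rw [inf_assoc, pcompl_inf_self])
      have h2 : (z ⊓ w)ᶜ ⊓ (q ⊓ a) ≤ zᶜ :=
        (PseudocomplDistribLattice.le_compl_iff_inf_eq_bot _ _).2
          (le_bot_iff.1 (le_trans (by rw [inf_right_comm]; exact inf_le_inf_right _ h1) hw.le))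
      refine le_bot_iff.1 (le_trans (le_inf (le_trans ?_ h2) ?_) hz.le)
      · exact inf_le_inf_left _ (inf_le_inf_right _ inf_le_right)
      · exact inf_le_right.trans (inf_le_inf_right _ inf_le_left)
    · rintro z w hzw ⟨p, hp, hz⟩
      exact ⟨p, hp, le_bot_iff.1 ((inf_le_inf_right _ (pcompl_le_pcompl hzw)).trans hz.le)⟩
  obtain ⟨J, hJ, -, hdisj⟩ := DistribLattice.prime_ideal_of_disjoint_filter_ideal
    (F := hs.toPFilter) (I := Ideal.principal (⊥ : L)) (by
      refine Set.disjoint_left.2 ?_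
      rintro z ⟨p, hp, hz⟩ hz'
      have hz0 : z = ⊥ := le_bot_iff.1 hz'
      change zᶜ ⊓ (p ⊓ a) = ⊥ at hz
      rw [hz0, pcompl_bot, top_inf_eq] at hz
      exact hp (I.lower ((PseudocomplDistribLattice.le_compl_iff_inf_eq_bot _ _).2 hz) ha))
  have hnot : ∀ z p, p ∉ I → zᶜ ⊓ (p ⊓ a) = ⊥ → z ∉ J := fun z p hp hz =>
    Set.disjoint_left.1 hdisj (show z ∈ s from ⟨p, hp, hz⟩)
  refine ⟨J, ⟨hJ, fun z hz => ?_, fun z hz hz' => ?_⟩, ?_⟩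
  · by_contra hzI
    exact hnot z z hzI
      (le_bot_iff.1 ((inf_le_inf_left _ inf_le_left).trans (pcompl_inf_self z).le)) hz
  · -- `z ⊔ zᶜ` is dense.
    refine hnot (z ⊔ zᶜ) ⊤ hI.top_notMem (le_bot_iff.1 (inf_le_left.trans ?_)) (J.sup_mem hz hz')
    rw [← pcompl_inf_self zᶜ]
    exact le_inf (pcompl_le_pcompl le_sup_right) (pcompl_le_pcompl le_sup_left)
  · exact hnot a ⊤ hI.top_notMem
      (le_bot_iff.1 ((inf_le_inf_left _ inf_le_right).trans (pcompl_inf_self a).le))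

/-- In an algebra of `𝓑_n`, a prime ideal contains at most `n` minimal prime ideals. -/
theorem not_injective_minimalPrimesBelow {n : ℕ} (hn : 1 ≤ n) (hL : MemB n L) {I : Ideal L}
    (hI : I.IsPrime) (J : Fin (n + 1) → minimalPrimesBelow I) : ¬ Function.Injective J := by
  intro hJ
  have hsep : ∀ i j : Fin (n + 1), ∃ b : L, b ∉ (J i).1 ∧ (i ≠ j → b ∈ (J j).1) := by
    intro i j
    by_cases hij : i = j
    · exact ⟨⊤, (J i).2.1.top_notMem, fun h => absurd hij h⟩
    · obtain ⟨b, hb, hb'⟩ := exists_mem_notMem_of_ne (J i).2 (J j).2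
        fun h => hij (hJ (Subtype.ext h))
      exact ⟨b, hb', fun _ => hb⟩
  choose b hb hb' using hsep
  -- Meets of the separating elements give `a i` lying in every `J j` with `j ≠ i` but not in `J i`.
  let a : ℕ → L := fun i =>
    if h : i < n + 1 then Finset.univ.inf (b ⟨i, h⟩) else ⊥
  have ha : ∀ i : Fin (n + 1), a i = Finset.univ.inf (b i) := fun i => dif_pos i.2
  have hnot : ∀ i : Fin (n + 1), a i ∉ (J i).1 := by
    intro i
    rw [ha]
    refine Finset.inf_induction (p := fun z => z ∉ (J i).1) ?_ ?_ fun j _ => hb i j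
    · exact (J i).2.1.top_notMem
    · exact fun x hx y hy h => ((J i).2.1.mem_or_mem h).elim hx hy
  have hmem : ∀ i j : Fin (n + 1), i ≠ j → a i ∈ (J j).1 := fun i j hij =>
    (J j).1.lower ((ha i).le.trans (Finset.inf_le (Finset.mem_univ j))) (hb' i j hij)
  have hinf : ∀ (i : Fin (n + 1)) (m : ℕ), m ≤ i → (infCompl m).eval a ∉ (J i).1 := by
    intro i m
    induction m with
    | zero =>
      exact fun _ => (J i).2.1.top_notMem
    | succ m ih =>
      intro hm h
      refine ((J i).2.1.mem_or_mem h).elim (ih (by omega)) ?_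
      exact (J i).2.2.2 _ (hmem ⟨m, by omega⟩ i (Fin.ne_of_lt hm))
  have hsup : ∀ m ≤ n + 1, (supComplDisjointed m).eval a ∈ I := by
    intro m
    induction m with
    | zero => exact fun _ => I.bot_mem
    | succ m ih =>
      intro hm
      refine I.sup_mem (ih (by omega)) ((J ⟨m, hm⟩).2.2.1 ((J ⟨m, hm⟩).2.1.pcompl_mem ?_))
      exact fun h => ((J ⟨m, hm⟩).2.1.mem_or_mem h).elim (hnot ⟨m, hm⟩) (hinf ⟨m, hm⟩ m le_rfl)
  have htop := hsup (n + 1) le_rfl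
  rw [hL _ _ (BPlus.satisfies_supComplDisjointed hn) a] at htop
  exact hI.top_notMem htop

theorem exists_range_eq_minimalPrimesBelow {n : ℕ} (hn : 1 ≤ n) (hL : MemB n L) {I : Ideal L}
    (hI : I.IsPrime) : ∃ J : Fin n → Ideal L, Set.range J = minimalPrimesBelow I := by
  obtain ⟨K, hK, -⟩ := exists_minimalPrimesBelow_notMem (a := ⊤) hI (by
    have h : (⊤ : L)ᶜ = ⊥ := by rw [← pcompl_inf_self (⊤ : L), inf_top_eq]
    rw [h]
    exact I.bot_mem)
  have : Nonempty (minimalPrimesBelow I) := ⟨⟨K, hK⟩⟩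
  have hfin : Finite (minimalPrimesBelow I) := by
    by_contra h
    rw [not_finite_iff_infinite] at h
    exact not_injective_minimalPrimesBelow hn hL hI
      (fun i => Infinite.natEmbedding (minimalPrimesBelow I) i)
      ((Infinite.natEmbedding _).injective.comp Fin.val_injective)
  have := Fintype.ofFinite (minimalPrimesBelow I)
  have hcard : Fintype.card (minimalPrimesBelow I) ≤ Fintype.card (Fin n) := by
    by_contra! h
    rw [Fintype.card_fin] at h
    obtain ⟨e⟩ := Function.Embedding.nonempty_of_card_le
      (α := Fin (n + 1)) (β := minimalPrimesBelow I) (by rw [Fintype.card_fin]; exact h)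
    exact not_injective_minimalPrimesBelow hn hL hI e e.injective
  obtain ⟨e⟩ := Function.Embedding.nonempty_of_card_le hcard
  refine ⟨fun i => (Function.invFun e i).1, ?_⟩
  change Set.range (Subtype.val ∘ Function.invFun e) = _
  rw [Set.range_comp, (Function.invFun_surjective e.injective).range_eq, Set.image_univ,
    Subtype.range_coe]

end MinimalPrimes

/-! ### Homomorphisms into `2^n ⊕ 1` -/

section Separation

open Order

variable {L : Type u} [PseudocomplDistribLattice L]

open Classical in
/-- The map sending the elements outside `I` to the new top of `2^n ⊕ 1` and `a ∈ I` to the set of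
those `i` with `a ∉ J i`, regarded as an element of `2^n`. -/
noncomputable def toBPlus {n : ℕ} (I : Ideal L) (J : Fin n → Ideal L) (a : L) : BPlus n :=
  if a ∈ I then ((fun i => decide (a ∉ J i) : Fin n → Bool) : WithTop (Fin n → Bool)) else ⊤

theorem toBPlus_of_notMem {n : ℕ} {I : Ideal L} (J : Fin n → Ideal L) {a : L} (ha : a ∉ I) :
    toBPlus I J a = ⊤ :=
  if_neg ha

open Classical in
theorem toBPlus_of_mem {n : ℕ} {I : Ideal L} (J : Fin n → Ideal L) {a : L} (ha : a ∈ I) :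
    toBPlus I J a =
      ((fun i => decide (a ∉ J i) : Fin n → Bool) : WithTop (Fin n → Bool)) :=
  if_pos ha

/-- `toBPlus I J` as a `*`-homomorphism, when `J` enumerates the minimal prime ideals below `I`. -/
noncomputable def toBPlusHom {n : ℕ} {I : Ideal L} (hI : I.IsPrime) {J : Fin n → Ideal L}
    (hJ : Set.range J = minimalPrimesBelow I) : PseudocomplHom L (BPlus n) :=
  have hJi : ∀ i, J i ∈ minimalPrimesBelow I := fun i => hJ ▸ Set.mem_range_self i
  { toFun := toBPlus I J
    map_sup' := fun a b => by
      by_cases ha : a ∈ I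
      · by_cases hb : b ∈ I
        · rw [toBPlus_of_mem J ha, toBPlus_of_mem J hb, toBPlus_of_mem J (I.sup_mem ha hb)]
          refine Eq.trans (congrArg _ (funext fun i => ?_)) (WithTop.coe_sup _ _)
          by_cases h1 : a ∈ J i <;> by_cases h2 : b ∈ J i <;> simp [h1, h2]
        · rw [toBPlus_of_notMem J hb, sup_top_eq]
          exact toBPlus_of_notMem J fun h => hb (I.lower le_sup_right h)
      · rw [toBPlus_of_notMem J ha, top_sup_eq]
        exact toBPlus_of_notMem J fun h => ha (I.lower le_sup_left h)
    map_inf' := fun a b => by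
      have hcap : ∀ i, a ⊓ b ∈ J i ↔ a ∈ J i ∨ b ∈ J i := fun i =>
        ⟨fun h => (hJi i).1.mem_or_mem h,
          fun h => h.elim ((J i).lower inf_le_left) ((J i).lower inf_le_right)⟩
      by_cases ha : a ∈ I
      · rw [toBPlus_of_mem J ha, toBPlus_of_mem J (I.lower inf_le_left ha)]
        by_cases hb : b ∈ I
        · rw [toBPlus_of_mem J hb]
          refine Eq.trans (congrArg _ (funext fun i => ?_)) (WithTop.coe_inf _ _)
          by_cases h1 : a ∈ J i <;> by_cases h2 : b ∈ J i <;> simp [hcap, h1, h2]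
        · rw [toBPlus_of_notMem J hb]
          refine Eq.trans (congrArg _ (funext fun i => ?_)) (inf_top_eq _).symm
          have hbi : b ∉ J i := fun h => hb ((hJi i).2.1 h)
          simp [hcap, hbi]
      · rw [toBPlus_of_notMem J ha, top_inf_eq]
        by_cases hb : b ∈ I
        · rw [toBPlus_of_mem J hb, toBPlus_of_mem J (I.lower inf_le_right hb)]
          refine congrArg _ (funext fun i => ?_)
          have hai : a ∉ J i := fun h => ha ((hJi i).2.1 h)
          simp [hcap, hai]
        · rw [toBPlus_of_notMem J hb]
          exact toBPlus_of_notMem J fun h => (hI.mem_or_mem h).elim ha hb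
    map_top' := toBPlus_of_notMem J hI.top_notMem
    map_bot' := by
      refine (toBPlus_of_mem J I.bot_mem).trans (congrArg _ (funext fun i => ?_))
      simp
    map_compl' := fun a => by
      have hiff : ∀ i, aᶜ ∈ J i ↔ a ∉ J i := fun i =>
        ⟨fun h h' => (hJi i).2.2 a h' h, (hJi i).1.pcompl_mem⟩
      by_cases ha : a ∈ I
      · rw [toBPlus_of_mem J ha]
        change _ = BPlus.pcompl n (some _)
        by_cases hac : aᶜ ∈ I
        · obtain ⟨K, hK, haK⟩ := exists_minimalPrimesBelow_notMem hI hac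
          obtain ⟨i, rfl⟩ : K ∈ Set.range J := hJ ▸ hK
          rw [toBPlus_of_mem J hac, BPlus.pcompl, if_neg]
          · refine congrArg _ (funext fun j => ?_)
            by_cases h : a ∈ J j <;> simp [hiff, h]
          · intro h
            have h' := congrFun h i
            simp [haK] at h'
        · rw [toBPlus_of_notMem J hac, BPlus.pcompl, if_pos]
          · rfl
          · funext i
            have : a ∈ J i := by
              by_contra h
              exact hac ((hJi i).2.1 ((hiff i).2 h))
            simp [this]
      · rw [toBPlus_of_notMem J ha, toBPlus_of_mem J (hI.pcompl_mem ha)]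
        refine congrArg (WithTop.some) (funext fun i => ?_)
        have hai : a ∉ J i := fun h => ha ((hJi i).2.1 h)
        simp [hiff, hai] }

/-- Homomorphisms into `2^n ⊕ 1` separate the points of every algebra of `𝓑_n`. -/
theorem exists_hom_ne {n : ℕ} (hn : 1 ≤ n) (hL : MemB n L) {x y : L} (hxy : x ≠ y) :
    ∃ g : PseudocomplHom L (BPlus n), g x ≠ g y := by
  wlog h : ¬ x ≤ y generalizing x y
  · obtain ⟨g, hg⟩ := this hxy.symm fun h' => hxy (le_antisymm (not_not.1 h) h')
    exact ⟨g, hg.symm⟩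
  obtain ⟨I, hI, hyI, hdisj⟩ := DistribLattice.prime_ideal_of_disjoint_filter_ideal
    (F := PFilter.principal x) (I := Ideal.principal y)
    (Set.disjoint_left.2 fun z hz hz' => h (le_trans (PFilter.mem_principal.1 hz) hz'))
  have hy : y ∈ I := hyI (Ideal.mem_principal.2 le_rfl)
  have hx : x ∉ I := Set.disjoint_left.1 hdisj (PFilter.mem_principal.2 le_rfl)
  obtain ⟨J, hJ⟩ := exists_range_eq_minimalPrimesBelow hn hL hI
  refine ⟨toBPlusHom hI hJ, ?_⟩
  change toBPlus I J x ≠ toBPlus I J y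
  rw [toBPlus_of_notMem J hx, toBPlus_of_mem J hy]
  exact WithTop.top_ne_coe

end Separation

/-! ### Amalgamation -/

theorem mainTheorem4 (n : ℕ) (hn : 2 ≤ n) (A : Type u) [PseudocomplDistribLattice A]
    (hA : MemB n A)
    (hext : ∀ (B : Type u) [PseudocomplDistribLattice B], MemB n B →
      ∀ ι : PseudocomplHom A B, Function.Injective ι →
      ∀ f : PseudocomplHom A (BPlus n),
        ∃ g : PseudocomplHom B (BPlus n), ∀ a : A, g (ι a) = f a) :
    IsAmalgamationBase (fun (L : Type u) [PseudocomplDistribLattice L] => MemB n L) A := by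
  have hn1 : 1 ≤ n := by omega
  refine ⟨hA, fun B₀ B₁ _ _ hB₀ hB₁ α₀ α₁ hα₀ hα₁ => ?_⟩
  let S : Type u := {g : PseudocomplHom B₀ (BPlus n) × PseudocomplHom B₁ (BPlus n) //
    ∀ a, g.1 (α₀ a) = g.2 (α₁ a)}
  refine ⟨S → BPlus n, inferInstance, memVarietyGeneratedBy_pi,
    PseudocomplHom.pi fun s => s.1.1, PseudocomplHom.pi fun s => s.1.2, ?_, ?_,
    fun a => funext fun s => s.2 a⟩
  · intro x y hxy
    by_contra hne
    obtain ⟨g₀, hg₀⟩ := exists_hom_ne hn1 hB₀ hne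
    obtain ⟨g₁, hg₁⟩ := hext B₁ hB₁ α₁ hα₁ (g₀.comp α₀)
    exact hg₀ (congrFun hxy (⟨(g₀, g₁), fun a => (hg₁ a).symm⟩ : S))
  · intro x y hxy
    by_contra hne
    obtain ⟨g₁, hg₁⟩ := exists_hom_ne hn1 hB₁ hne
    obtain ⟨g₀, hg₀⟩ := hext B₀ hB₀ α₀ hα₀ (g₁.comp α₁)
    exact hg₁ (congrFun hxy (⟨(g₀, g₁), hg₀⟩ : S))
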